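/- Let $m\ge 1$ and let $\Lambda=\{\lambda_\alpha\}_{\alpha\in\mathbb{N}^m}$ be a family of positive numbers (a weight set). Let $\mathcal{M}_\Lambda$ be the Hilbert space completion of $\mathbb{C}[z_1,\dots,z_m]$ for the inner product in which the monomials $z^\alpha$ are mutually orthogonal with $\|z^\alpha\|=\lambda_\alpha$. Assume that multiplication by each coordinate function $z_i$ is bounded in this norm, so that it extends to a bounded operator $Z_i$ on $\mathcal{M}_\Lambda$ (the $Z_i$ are commuting weighted shifts), and that the cross-commutators $[Z_i^*,Z_j]=Z_i^*Z_j-Z_jZ_i^*$, $1\le i,j\le m$, are trace class. For $1\le k<\infty$ denote the operator $Z_i\otimes 1$ on $\mathcal{M}_\Lambda\otimes\mathbb{C}^k$ again by $Z_i$. Let $\mathcal{S}$ be a submodule of $\mathcal{M}_\Lambda\otimes\mathbb{C}^k$, that is, a closed subspace invariant under $Z_1,\dots,Z_m$, and put $Y_i=Z_i|_{\mathcal{S}}$. If $\mathcal{S}^\perp$ is generated by polynomials, that is, if there is a set $G$ of $\mathbb{C}^k$-valued polynomials such that $\mathcal{S}^\perp$ is the smallest closed subspace that contains $G$ and is invariant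 under $Z_1^*,\dots,Z_m^*$ (for instance, if $\mathcal{S}^\perp$ is the closed linear span of the polynomials it contains), then the cross-commutators $[Y_i^*,Y_j]$ are trace class for all $1\le i,j\le m$. In particular, $[Y_i^*,Y_j]$ is trace class for all $1\le i,j\le m$ if $\mathcal{S}$ is homogeneous, that is, if $\mathcal{S}$ is the smallest closed subspace that contains some set of homogeneous $\mathbb{C}^k$-valued polynomials and is invariant under $Z_1,\dots,Z_m$. -/

import Mathlib

open scoped TensorProduct InnerProductSpace ENNReal

/-! ### Trace-class operators -/

/-- `T` is trace class: the trace of `|T| = (T* T)^(1/2)`, computed in an orthonormal basis of `H`,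
is finite. (The terms `⟪b i, |T| (b i)⟫` are nonnegative reals and their sum does not depend on
the basis.) -/
def IsTraceClass {H : Type*} [NormedAddCommGroup H] [InnerProductSpace ℂ H] [CompleteSpace H]
    (T : H →L[ℂ] H) : Prop :=
  ∃ (w : Set H) (b : HilbertBasis w ℂ H),
    Summable fun i => (inner ℂ (b i) (CFC.abs T (b i))).re

/-- The cross-commutator `[A*, B] = A* B - B A*`. -/
noncomputable def crossCommutator {H : Type*} [NormedAddCommGroup H] [InnerProductSpace ℂ H]
    [CompleteSpace H] (A B : H →L[ℂ] H) : H →L[ℂ] H :=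
  ContinuousLinearMap.adjoint A * B - B * ContinuousLinearMap.adjoint A

/-- The smallest closed subspace that contains `G` and is invariant under all the `T i`. -/
def closedSubmoduleGenerated {ι : Type*} {H : Type*} [NormedAddCommGroup H]
    [InnerProductSpace ℂ H] (T : ι → H →L[ℂ] H) (G : Set H) : Submodule ℂ H :=
  sInf {V | IsClosed (V : Set H) ∧ (∀ i, ∀ v ∈ V, T i v ∈ V) ∧ G ⊆ V}

/-! ### The Hilbert module of a weight set -/

/-- A weight set for the multi-indices in `m` variables: a family of positive numbers `λ_α`. -/
structure WeightSet (m : ℕ) where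
  weight : (Fin m →₀ ℕ) → ℝ
  weight_pos : ∀ α, 0 < weight α

namespace WeightSet

/-- The Hilbert space `M_Λ`: the completion of `ℂ[z₁, …, z_m]` for the inner product in which the
monomials `z^α` are orthogonal with `‖z^α‖ = λ_α`. It is realised as `ℓ²` of the multi-indices, in
coordinates with respect to the orthonormal basis `z^α / λ_α`; the polynomials are embedded by
`ofPoly`. -/
abbrev Space {m : ℕ} (_Λ : WeightSet m) : Type :=
  lp (fun _ : Fin m →₀ ℕ => ℂ) 2

/-- The dense embedding of `ℂ[z₁, …, z_m]` in `M_Λ`: the coordinate of `p = ∑ c_α z^α` along the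
unit vector `z^α / λ_α` is `λ_α c_α`. -/
noncomputable def ofPoly {m : ℕ} (Λ : WeightSet m) : MvPolynomial (Fin m) ℂ →ₗ[ℂ] Λ.Space where
  toFun p := ⟨fun α => (Λ.weight α : ℂ) * p.coeff α, by
    refine memℓp_gen (summable_of_hasFiniteSupport (p.support.finite_toSet.subset ?_))
    intro α hα
    by_contra h
    have h0 : p.coeff α = 0 := by simpa using h
    simp [h0] at hα⟩
  map_add' p q := by
    ext α
    change (Λ.weight α : ℂ) * (p + q).coeff α = _
    rw [MvPolynomial.coeff_add, mul_add]
    rfl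
  map_smul' c p := by
    ext α
    simp [mul_left_comm]

theorem ofPoly_apply {m : ℕ} (Λ : WeightSet m) (p : MvPolynomial (Fin m) ℂ) (α : Fin m →₀ ℕ) :
    Λ.ofPoly p α = (Λ.weight α : ℂ) * p.coeff α := rfl

theorem ofPoly_monomial {m : ℕ} (Λ : WeightSet m) (α : Fin m →₀ ℕ) (c : ℂ) :
    Λ.ofPoly (MvPolynomial.monomial α c) = lp.single 2 α ((Λ.weight α : ℂ) * c) := by
  ext β
  rw [ofPoly_apply, MvPolynomial.coeff_monomial, lp.single_apply]
  by_cases h : α = β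
  · subst h
    simp
  · simp [h, Ne.symm h]

theorem inner_ofPoly_monomial {m : ℕ} (Λ : WeightSet m) (α β : Fin m →₀ ℕ) :
    inner ℂ (Λ.ofPoly (MvPolynomial.monomial α 1)) (Λ.ofPoly (MvPolynomial.monomial β 1)) =
      if α = β then ((Λ.weight α : ℂ)) ^ 2 else 0 := by
  rw [ofPoly_monomial, ofPoly_monomial, lp.inner_single_left, lp.single_apply]
  by_cases h : α = β
  · subst h
    simp [sq, abs_of_pos (Λ.weight_pos α)]
  · simp [h]

theorem denseRange_ofPoly {m : ℕ} (Λ : WeightSet m) : DenseRange Λ.ofPoly := by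
  intro f
  refine mem_closure_of_tendsto (lp.hasSum_single (by simp) f) (Filter.Eventually.of_forall ?_)
  intro s
  refine (LinearMap.range Λ.ofPoly).sum_mem fun α _ => ?_
  refine ⟨MvPolynomial.monomial α ((Λ.weight α : ℂ)⁻¹ * f α), ?_⟩
  have h : (Λ.weight α : ℂ) ≠ 0 := by exact_mod_cast (Λ.weight_pos α).ne'
  rw [ofPoly_monomial, mul_inv_cancel_left₀ h]

/-- Multiplication by every coordinate function `z_i` is bounded on the polynomials, in the norm of
`M_Λ`. -/
def HasBoundedShifts {m : ℕ} (Λ : WeightSet m) : Prop :=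
  ∀ i : Fin m, ∃ C : ℝ, ∀ p : MvPolynomial (Fin m) ℂ,
    ‖Λ.ofPoly (MvPolynomial.X i * p)‖ ≤ C * ‖Λ.ofPoly p‖

/-- The weighted shift `Z_i` on `M_Λ`: the continuous extension of the multiplication of polynomials
by `z_i` (meaningful under `HasBoundedShifts`, see `shift_ofPoly`). -/
noncomputable def shift {m : ℕ} (Λ : WeightSet m) (i : Fin m) : Λ.Space →L[ℂ] Λ.Space :=
  (Λ.ofPoly ∘ₗ LinearMap.mulLeft ℂ (MvPolynomial.X i)).extendOfNorm Λ.ofPoly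

theorem shift_ofPoly {m : ℕ} (Λ : WeightSet m) (h : Λ.HasBoundedShifts) (i : Fin m)
    (p : MvPolynomial (Fin m) ℂ) :
    Λ.shift i (Λ.ofPoly p) = Λ.ofPoly (MvPolynomial.X i * p) :=
  LinearMap.extendOfNorm_eq Λ.denseRange_ofPoly (h i) p

/-- The cross-commutators `[Z_i*, Z_j]` of the coordinate multipliers on `M_Λ` are trace class. -/
def HasTraceClassCommutators {m : ℕ} (Λ : WeightSet m) : Prop :=
  ∀ i j : Fin m, IsTraceClass (crossCommutator (Λ.shift i) (Λ.shift j))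

/-! ### Finite multiplicity -/

/-- The Hilbert space `M_Λ ⊗ ℂ^k`, with the tensor product inner product
`⟪f ⊗ v, g ⊗ w⟫ = ⟪f, g⟫ * ⟪v, w⟫`. -/
def TensorSpace {m : ℕ} (Λ : WeightSet m) (k : ℕ) : Type :=
  Λ.Space ⊗[ℂ] EuclideanSpace ℂ (Fin k)

noncomputable instance instNormedAddCommGroupTensorSpace {m : ℕ} (Λ : WeightSet m) (k : ℕ) :
    NormedAddCommGroup (Λ.TensorSpace k) :=
  inferInstanceAs (NormedAddCommGroup (Λ.Space ⊗[ℂ] EuclideanSpace ℂ (Fin k)))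

noncomputable instance instInnerProductSpaceTensorSpace {m : ℕ} (Λ : WeightSet m) (k : ℕ) :
    InnerProductSpace ℂ (Λ.TensorSpace k) :=
  inferInstanceAs (InnerProductSpace ℂ (Λ.Space ⊗[ℂ] EuclideanSpace ℂ (Fin k)))

/-- The elementary tensor `f ⊗ v` in `M_Λ ⊗ ℂ^k`. -/
noncomputable def tmul {m : ℕ} (Λ : WeightSet m) {k : ℕ} (f : Λ.Space) (v : EuclideanSpace ℂ (Fin k)) :
    Λ.TensorSpace k :=
  f ⊗ₜ[ℂ] v

/-- As `ℂ^k` is finite dimensional, the algebraic tensor product is already complete. -/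
instance instCompleteSpaceTensorSpace {m : ℕ} (Λ : WeightSet m) (k : ℕ) :
    CompleteSpace (Λ.TensorSpace k) := by
  suffices h : CompleteSpace (Λ.Space ⊗[ℂ] EuclideanSpace ℂ (Fin k)) from h
  let e := EuclideanSpace.basisFun (Fin k) ℂ
  let g : PiLp 2 (fun _ : Fin k => Λ.Space) →ₗ[ℂ] Λ.Space ⊗[ℂ] EuclideanSpace ℂ (Fin k) :=
    { toFun := fun f => ∑ j, f j ⊗ₜ[ℂ] e j
      map_add' := fun f f' => by simp [TensorProduct.add_tmul, Finset.sum_add_distrib]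
      map_smul' := fun c f => by simp [TensorProduct.smul_tmul', Finset.smul_sum] }
  have hnorm : ∀ f, ‖g f‖ = ‖f‖ := by
    intro f
    have h : inner ℂ (g f) (g f) = inner ℂ f f := by
      change inner ℂ (∑ j, f j ⊗ₜ[ℂ] e j) (∑ j, f j ⊗ₜ[ℂ] e j) = _
      simp only [inner_sum, sum_inner, TensorProduct.inner_tmul,
        orthonormal_iff_ite.mp e.orthonormal, PiLp.inner_apply]
      simp
    rw [@norm_eq_sqrt_re_inner ℂ, @norm_eq_sqrt_re_inner ℂ, h]
  have hsurj : Function.Surjective g := by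
    intro x
    induction x using TensorProduct.induction_on with
    | zero => exact ⟨0, map_zero g⟩
    | tmul a v =>
      refine ⟨WithLp.toLp 2 fun j => v j • a, ?_⟩
      change ∑ j, (v j • a) ⊗ₜ[ℂ] e j = a ⊗ₜ[ℂ] v
      simp only [TensorProduct.smul_tmul, ← TensorProduct.tmul_sum]
      congr 1
      have := e.sum_repr v
      simpa [e] using this
    | add x y hx hy =>
      obtain ⟨f, rfl⟩ := hx
      obtain ⟨f', rfl⟩ := hy
      exact ⟨f + f', map_add g f f'⟩
  let L : PiLp 2 (fun _ : Fin k => Λ.Space) →ₗᵢ[ℂ]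
      Λ.Space ⊗[ℂ] EuclideanSpace ℂ (Fin k) := ⟨g, hnorm⟩
  exact L.isometry.isUniformInducing.completeSpace_congr hsurj |>.1 inferInstance

/-- The operator `Z_i ⊗ 1` on `M_Λ ⊗ ℂ^k`. -/
noncomputable def tensorShift {m : ℕ} (Λ : WeightSet m) (k : ℕ) (i : Fin m) :
    Λ.TensorSpace k →L[ℂ] Λ.TensorSpace k :=
  (Λ.shift i).rTensor (EuclideanSpace ℂ (Fin k))

theorem tensorShift_tmul {m : ℕ} (Λ : WeightSet m) (k : ℕ) (i : Fin m) (f : Λ.Space)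
    (v : EuclideanSpace ℂ (Fin k)) :
    Λ.tensorShift k i (Λ.tmul f v) = Λ.tmul (Λ.shift i f) v := rfl

/-- The restriction `Y_i = Z_i|_S` of the coordinate multiplier `Z_i ⊗ 1` to an invariant
subspace `S`. -/
noncomputable def restrictedShift {m : ℕ} (Λ : WeightSet m) (k : ℕ)
    (S : Submodule ℂ (Λ.TensorSpace k)) (hS : ∀ i, ∀ f ∈ S, Λ.tensorShift k i f ∈ S)
    (i : Fin m) : S →L[ℂ] S :=
  (Λ.tensorShift k i).restrict (hS i)

/-- The `ℂ^k`-valued polynomials in `M_Λ ⊗ ℂ^k`, that is, the image of `ℂ[z] ⊗ ℂ^k`. -/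
noncomputable def polynomials {m : ℕ} (Λ : WeightSet m) (k : ℕ) :
    Submodule ℂ (Λ.TensorSpace k) :=
  Submodule.span ℂ {x | ∃ (p : MvPolynomial (Fin m) ℂ) (v : EuclideanSpace ℂ (Fin k)),
    x = Λ.tmul (Λ.ofPoly p) v}

/-- The homogeneous `ℂ^k`-valued polynomials of degree `n` in `M_Λ ⊗ ℂ^k`. -/
noncomputable def homogeneousPolynomials {m : ℕ} (Λ : WeightSet m) (k n : ℕ) :
    Submodule ℂ (Λ.TensorSpace k) :=
  Submodule.span ℂ {x | ∃ (p : MvPolynomial (Fin m) ℂ) (v : EuclideanSpace ℂ (Fin k)),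
    p.IsHomogeneous n ∧ x = Λ.tmul (Λ.ofPoly p) v}

/-- A subspace of `M_Λ ⊗ ℂ^k` that is generated by polynomials as a (closed) module for the adjoints
`(Z_i ⊗ 1)*`; for instance the closed linear span of a set of polynomials, when it is invariant. -/
def IsGeneratedByPolynomials {m : ℕ} (Λ : WeightSet m) (k : ℕ)
    (V : Submodule ℂ (Λ.TensorSpace k)) : Prop :=
  ∃ G : Set (Λ.TensorSpace k), G ⊆ Λ.polynomials k ∧
    V = closedSubmoduleGenerated (fun i => ContinuousLinearMap.adjoint (Λ.tensorShift k i)) G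

/-- A homogeneous submodule of `M_Λ ⊗ ℂ^k`: one that is generated, as a closed module for the
`Z_i ⊗ 1`, by homogeneous polynomials (possibly of different degrees). -/
def IsHomogeneousSubmodule {m : ℕ} (Λ : WeightSet m) (k : ℕ)
    (S : Submodule ℂ (Λ.TensorSpace k)) : Prop :=
  ∃ G : Set (Λ.TensorSpace k), (∀ g ∈ G, ∃ n, g ∈ Λ.homogeneousPolynomials k n) ∧
    S = closedSubmoduleGenerated (Λ.tensorShift k) G

end WeightSet

/-!
Let `P` be the projection onto `S` and `A_i = P Z_i P^⊥`. As `S` is invariant, the compression of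
`[Z_i*, Z_j]` to `S` differs from `[Y_i*, Y_j]` by `A_j A_i*` (`crossCommutator_restrict`), so it
suffices that every `A_i` is Hilbert–Schmidt.

For this, exhaust `S^⊥` by the finite-dimensional subspaces `F` of its polynomials of degree at most
`n`. The adjoints lower the degree and preserve `S^⊥`, so `F` is invariant under `Z_i*`. The
Hilbert–Schmidt norm of `Z_i*` on `F` is therefore that of the compression of `Z_i` to `F`, and for
an orthonormal basis `f` of `F` this gives
`∑ ‖P Z_i f‖² ≤ ∑ (‖Z_i f‖² - ‖P_F Z_i f‖²) = ∑ (‖Z_i f‖² - ‖Z_i* f‖²) = tr_F [Z_i*, Z_i]`,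
which is bounded by the trace norm of `[Z_i*, Z_i]`, independently of `n`
(`sum_norm_sq_orthogonalProjectionOnto_le`, `isHilbertSchmidt_corner`).

It remains that the polynomials in `S^⊥` are dense in it. If `S^⊥` is generated by polynomials, their
closure is an invariant subspace that contains the generators
(`topologicalClosure_iSup_inf_degreeLE_of_generated`). If `S` is homogeneous, the projections onto the
polynomials of degree at most `n` preserve `S`, hence `S^⊥`, and they converge strongly to the
identity (`topologicalClosure_iSup_inf_degreeLE_of_homogeneous`).

Trace-class operators are handled as products of Hilbert–Schmidt operators: the polar decomposition
`T = U |T|` gives the factorization of a trace-class `T` (`IsTraceClass.exists_eq_comp`), and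
`|T| = U* T` gives the converse (`isTraceClass_comp_add_comp`).
-/

/-! ### Hilbert–Schmidt operators -/

section HilbertSchmidt

open ContinuousLinearMap

variable {H K L : Type*}
  [NormedAddCommGroup H] [InnerProductSpace ℂ H]
  [NormedAddCommGroup K] [InnerProductSpace ℂ K]
  [NormedAddCommGroup L] [InnerProductSpace ℂ L]

/-- The squared Hilbert–Schmidt norm of `T` is at most `M`: over every finite orthonormal set, the
sum of the `‖T x‖ ^ 2` is at most `M`. -/
def HilbertSchmidtBound (T : H →L[ℂ] K) (M : ℝ) : Prop :=
  ∀ s : Finset H, Orthonormal ℂ ((↑) : s → H) → ∑ x ∈ s, ‖T x‖ ^ 2 ≤ M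

/-- `T` is a Hilbert–Schmidt operator. -/
def IsHilbertSchmidt (T : H →L[ℂ] K) : Prop := ∃ M, HilbertSchmidtBound T M

theorem HilbertSchmidtBound.sum_le {T : H →L[ℂ] K} {M : ℝ} (h : HilbertSchmidtBound T M)
    {ι : Type*} {e : ι → H} (he : Orthonormal ℂ e) (s : Finset ι) :
    ∑ i ∈ s, ‖T (e i)‖ ^ 2 ≤ M := by
  classical
  have hinj : Function.Injective e := he.linearIndependent.injective
  rw [← Finset.sum_image (f := fun x => ‖T x‖ ^ 2) (g := e) fun _ _ _ _ h => hinj h]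
  refine h _ ?_
  have hsub : ∀ x : (s.image e : Finset H), (x : H) ∈ Set.range e := by
    rintro ⟨x, hx⟩
    obtain ⟨i, -, rfl⟩ := Finset.mem_image.mp hx
    exact ⟨i, rfl⟩
  exact he.toSubtypeRange.comp (fun x : (s.image e : Finset H) => ⟨x, hsub x⟩)
    fun x y hxy => Subtype.ext (congrArg (fun z : Set.range e => (z : H)) hxy)

theorem IsHilbertSchmidt.summable {T : H →L[ℂ] K} (h : IsHilbertSchmidt T)
    {ι : Type*} {e : ι → H} (he : Orthonormal ℂ e) : Summable fun i => ‖T (e i)‖ ^ 2 := by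
  obtain ⟨M, hM⟩ := h
  exact summable_of_sum_le (fun _ => by positivity) (hM.sum_le he)

/-- A bound for `∑ ‖T (b i)‖ ^ 2` over one orthonormal basis bounds the adjoint over every
orthonormal set: expand `T† x` in the basis, exchange the sums and use Bessel's inequality. -/
theorem HilbertBasis.hilbertSchmidtBound_adjoint [CompleteSpace H] [CompleteSpace K]
    {ι : Type*} (b : HilbertBasis ι ℂ H) {T : H →L[ℂ] K} {M : ℝ}
    (h : ∀ t : Finset ι, ∑ i ∈ t, ‖T (b i)‖ ^ 2 ≤ M) : HilbertSchmidtBound (adjoint T) M := by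
  intro s hs
  have hsum : HasSum (fun i => ∑ x ∈ s, ‖inner ℂ (T (b i)) x‖ ^ 2)
      (∑ x ∈ s, ‖adjoint T x‖ ^ 2) := by
    refine hasSum_sum fun x _ => ?_
    have h1 := b.hasSum_inner_mul_inner (adjoint T x) (adjoint T x)
    rw [inner_self_eq_norm_sq_to_K] at h1
    have h2 := Complex.hasSum_re h1
    convert h2 using 1
    · ext i
      rw [← inner_conj_symm (adjoint T x) (b i), adjoint_inner_right, RCLike.conj_mul]
      norm_cast
    · norm_cast
  refine hasSum_le_of_sum_le hsum fun t => le_trans (Finset.sum_le_sum fun i _ => ?_) (h t)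
  have := hs.sum_inner_products_le (T (b i)) (s := Finset.univ)
  rw [Finset.univ_eq_attach, Finset.sum_attach s (fun x => ‖inner ℂ x (T (b i))‖ ^ 2)] at this
  simpa only [norm_inner_symm] using this

theorem HilbertSchmidtBound.adjoint [CompleteSpace H] [CompleteSpace K] {T : H →L[ℂ] K} {M : ℝ}
    (h : HilbertSchmidtBound T M) : HilbertSchmidtBound (adjoint T) M := by
  obtain ⟨w, b, -⟩ := exists_hilbertBasis ℂ H
  exact b.hilbertSchmidtBound_adjoint (h.sum_le b.orthonormal)

theorem IsHilbertSchmidt.adjoint [CompleteSpace H] [CompleteSpace K] {T : H →L[ℂ] K}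
    (h : IsHilbertSchmidt T) : IsHilbertSchmidt (adjoint T) :=
  h.imp fun _ => HilbertSchmidtBound.adjoint

theorem IsHilbertSchmidt.clm_comp {T : H →L[ℂ] K} (h : IsHilbertSchmidt T) (V : K →L[ℂ] L) :
    IsHilbertSchmidt (V ∘L T) := by
  obtain ⟨M, hM⟩ := h
  refine ⟨‖V‖ ^ 2 * M, fun s hs => ?_⟩
  calc ∑ x ∈ s, ‖(V ∘L T) x‖ ^ 2 ≤ ∑ x ∈ s, ‖V‖ ^ 2 * ‖T x‖ ^ 2 := by
        refine Finset.sum_le_sum fun x _ => ?_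
        rw [← mul_pow]
        exact pow_le_pow_left₀ (norm_nonneg _) (V.le_opNorm _) 2
    _ ≤ ‖V‖ ^ 2 * M := by
        rw [← Finset.mul_sum]
        exact mul_le_mul_of_nonneg_left (hM s hs) (by positivity)

theorem IsHilbertSchmidt.comp_clm [CompleteSpace H] [CompleteSpace K] [CompleteSpace L]
    {T : H →L[ℂ] K} (h : IsHilbertSchmidt T) (V : L →L[ℂ] H) : IsHilbertSchmidt (T ∘L V) := by
  have := (h.adjoint.clm_comp (ContinuousLinearMap.adjoint V)).adjoint
  rwa [← ContinuousLinearMap.adjoint_comp, ContinuousLinearMap.adjoint_adjoint] at this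

theorem IsHilbertSchmidt.zero : IsHilbertSchmidt (0 : H →L[ℂ] K) := ⟨0, fun s _ => by simp⟩

theorem IsHilbertSchmidt.add {S T : H →L[ℂ] K} (hS : IsHilbertSchmidt S)
    (hT : IsHilbertSchmidt T) : IsHilbertSchmidt (S + T) := by
  obtain ⟨M, hM⟩ := hS
  obtain ⟨N, hN⟩ := hT
  refine ⟨2 * (M + N), fun s hs => ?_⟩
  calc ∑ x ∈ s, ‖(S + T) x‖ ^ 2 ≤ ∑ x ∈ s, 2 * (‖S x‖ ^ 2 + ‖T x‖ ^ 2) := by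
        refine Finset.sum_le_sum fun x _ => ?_
        exact (pow_le_pow_left₀ (norm_nonneg _) (norm_add_le _ _) 2).trans add_sq_le
    _ ≤ 2 * (M + N) := by
        rw [← Finset.mul_sum, Finset.sum_add_distrib]
        linarith [hM s hs, hN s hs]

theorem IsHilbertSchmidt.sum {ι : Type*} (s : Finset ι) {T : ι → H →L[ℂ] K}
    (h : ∀ i ∈ s, IsHilbertSchmidt (T i)) : IsHilbertSchmidt (∑ i ∈ s, T i) :=
  Finset.sum_induction T IsHilbertSchmidt (fun _ _ => .add) .zero h

/-- For Hilbert–Schmidt `A`, `B`, the quadratic form of `A B` is absolutely summable over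
orthonormal families. -/
theorem IsHilbertSchmidt.summable_inner_comp [CompleteSpace H] [CompleteSpace K]
    {A : K →L[ℂ] H} {B : H →L[ℂ] K} (hA : IsHilbertSchmidt A) (hB : IsHilbertSchmidt B)
    {ι : Type*} {e : ι → H} (he : Orthonormal ℂ e) :
    Summable fun i => ‖inner ℂ (e i) ((A ∘L B) (e i))‖ := by
  refine Summable.of_nonneg_of_le (fun _ => norm_nonneg _) (fun i => ?_)
    ((hA.adjoint.summable he).add (hB.summable he))
  rw [comp_apply, ← adjoint_inner_left]
  have h1 := norm_inner_le_norm (𝕜 := ℂ) (ContinuousLinearMap.adjoint A (e i)) (B (e i))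
  nlinarith [sq_nonneg (‖ContinuousLinearMap.adjoint A (e i)‖ - ‖B (e i)‖),
    sq_nonneg (‖ContinuousLinearMap.adjoint A (e i)‖ + ‖B (e i)‖)]

/-- A uniform form of `IsHilbertSchmidt.summable_inner_comp`. -/
theorem IsHilbertSchmidt.exists_sum_re_inner_comp_le [CompleteSpace H] [CompleteSpace K]
    {A : K →L[ℂ] H} {B : H →L[ℂ] K} (hA : IsHilbertSchmidt A) (hB : IsHilbertSchmidt B) :
    ∃ M, ∀ {n : ℕ} {e : Fin n → H}, Orthonormal ℂ e →
      ∑ i, (inner ℂ (e i) ((A ∘L B) (e i))).re ≤ M := by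
  obtain ⟨M, hM⟩ := hA.adjoint
  obtain ⟨N, hN⟩ := hB
  refine ⟨M + N, fun {n e} he => ?_⟩
  refine le_trans ?_ (add_le_add (hM.sum_le he Finset.univ) (hN.sum_le he Finset.univ))
  rw [← Finset.sum_add_distrib]
  refine Finset.sum_le_sum fun i _ => ?_
  rw [comp_apply, ← adjoint_inner_left]
  have h1 := (Complex.re_le_norm _).trans
    (norm_inner_le_norm (𝕜 := ℂ) (ContinuousLinearMap.adjoint A (e i)) (B (e i)))
  nlinarith [sq_nonneg (‖ContinuousLinearMap.adjoint A (e i)‖ - ‖B (e i)‖),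
    sq_nonneg (‖ContinuousLinearMap.adjoint A (e i)‖ + ‖B (e i)‖)]

end HilbertSchmidt

/-! ### Trace-class operators as products of Hilbert–Schmidt operators -/

section TraceClass

open ContinuousLinearMap

variable {H : Type*} [NormedAddCommGroup H] [InnerProductSpace ℂ H] [CompleteSpace H]

theorem ContinuousLinearMap.inner_abs_abs (T : H →L[ℂ] H) (x y : H) :
    inner ℂ (CFC.abs T x) (CFC.abs T y) = inner ℂ (T x) (T y) := by
  have hsa : adjoint (CFC.abs T) = CFC.abs T :=
    (IsSelfAdjoint.of_nonneg (CFC.abs_nonneg T)).star_eq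
  have h : (CFC.abs T) (CFC.abs T y) = adjoint T (T y) :=
    congrArg (fun A : H →L[ℂ] H => A y) (CFC.abs_mul_abs T)
  rw [← adjoint_inner_right, hsa, h, adjoint_inner_right]

/-- The polar decomposition. The operator `U` is the isometry `|T| x ↦ T x` of the closure of the
range of `|T|`, extended by zero. -/
theorem ContinuousLinearMap.exists_polarDecomposition (T : H →L[ℂ] H) :
    ∃ U : H →L[ℂ] H, T = U ∘L CFC.abs T ∧ CFC.abs T = adjoint U ∘L T := by
  set W := CFC.abs T with hW
  have hnorm : ∀ x, ‖T x‖ = ‖W x‖ := fun x => by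
    rw [@norm_eq_sqrt_re_inner ℂ, @norm_eq_sqrt_re_inner ℂ _ _ _ _ (W x), hW, inner_abs_abs]
  let R := (LinearMap.range W.toLinearMap).topologicalClosure
  have hR : ∀ x, W x ∈ R := fun x => Submodule.le_topologicalClosure _ ⟨x, rfl⟩
  have : CompleteSpace R :=
    (Submodule.isClosed_topologicalClosure _).completeSpace_coe
  let e : H →ₗ[ℂ] R := W.toLinearMap.codRestrict R hR
  have he : DenseRange e := by
    intro y
    rw [closure_subtype]
    have : ((↑) : R → H) '' Set.range e = LinearMap.range W.toLinearMap := by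
      ext z
      constructor
      · rintro ⟨_, ⟨x, rfl⟩, rfl⟩
        exact ⟨x, rfl⟩
      · rintro ⟨x, rfl⟩
        exact ⟨_, ⟨x, rfl⟩, rfl⟩
    rw [this]
    exact y.2
  let U₀ : R →L[ℂ] H := T.toLinearMap.extendOfNorm e
  have hU₀ : ∀ x, U₀ (e x) = T x := fun x =>
    LinearMap.extendOfNorm_eq he ⟨1, fun x => by rw [one_mul]; exact (hnorm x).le⟩ x
  let U : H →L[ℂ] H := U₀ ∘L R.orthogonalProjectionOnto
  have hU : ∀ x, U (W x) = T x := fun x => by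
    rw [← hU₀]
    exact congrArg U₀ (R.orthogonalProjectionOnto_mem_subspace_eq_self (e x))
  refine ⟨U, by ext x; exact (hU x).symm, ?_⟩
  ext x
  -- Both sides lie in `R` and have the same inner products with the dense range of `|T|`.
  have hmem : adjoint U (T x) ∈ R := by
    rw [← Submodule.orthogonal_orthogonal R, Submodule.mem_orthogonal]
    intro u hu
    rw [adjoint_inner_right]
    have : U u = 0 := by
      change U₀ (R.orthogonalProjectionOnto u) = 0
      rw [R.orthogonalProjectionOnto_eq_zero_iff.mpr hu, map_zero]
    rw [this, inner_zero_left]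
  have hperp : W x - adjoint U (T x) ∈ Rᗮ := by
    rw [Submodule.orthogonal_closure, Submodule.mem_orthogonal]
    rintro _ ⟨y, rfl⟩
    change inner ℂ (W y) _ = 0
    rw [inner_sub_right, adjoint_inner_right, hU, hW, inner_abs_abs, sub_self]
  have := R.inner_right_of_mem_orthogonal (R.sub_mem (hR x) hmem) hperp
  exact sub_eq_zero.mp (inner_self_eq_zero.mp this)

/-- A sum of two products of Hilbert–Schmidt operators is trace class, since the polar decomposition
writes `|T|` as such a sum. -/
theorem isTraceClass_comp_add_comp {K L : Type*}
    [NormedAddCommGroup K] [InnerProductSpace ℂ K] [CompleteSpace K]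
    [NormedAddCommGroup L] [InnerProductSpace ℂ L] [CompleteSpace L]
    {A : K →L[ℂ] H} {B : H →L[ℂ] K} {C : L →L[ℂ] H} {D : H →L[ℂ] L}
    (hA : IsHilbertSchmidt A) (hB : IsHilbertSchmidt B)
    (hC : IsHilbertSchmidt C) (hD : IsHilbertSchmidt D) :
    IsTraceClass (A ∘L B + C ∘L D) := by
  obtain ⟨w, b, -⟩ := exists_hilbertBasis ℂ H
  refine ⟨w, b, ?_⟩
  obtain ⟨U, -, hU⟩ := (A ∘L B + C ∘L D).exists_polarDecomposition
  have h := ((hA.clm_comp (adjoint U)).summable_inner_comp hB b.orthonormal).add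
    ((hC.clm_comp (adjoint U)).summable_inner_comp hD b.orthonormal)
  refine Summable.of_norm_bounded h fun i => ?_
  rw [Real.norm_eq_abs]
  refine (Complex.abs_re_le_norm _).trans ?_
  rw [hU]
  refine le_trans (le_of_eq ?_) (norm_add_le _ _)
  congr 1
  simp

/-- A trace-class operator is a product of Hilbert–Schmidt operators, namely
`T = (U |T|^(1/2)) |T|^(1/2)`. -/
theorem IsTraceClass.exists_eq_comp {T : H →L[ℂ] H} (hT : IsTraceClass T) :
    ∃ A B : H →L[ℂ] H, IsHilbertSchmidt A ∧ IsHilbertSchmidt B ∧ T = A ∘L B := by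
  obtain ⟨w, b, hb⟩ := hT
  obtain ⟨U, hU, -⟩ := T.exists_polarDecomposition
  set W := CFC.abs T with hW
  have hWn : 0 ≤ W := CFC.abs_nonneg T
  set Q := CFC.sqrt W with hQ
  have hQQ : Q * Q = W := CFC.sqrt_mul_sqrt_self W hWn
  have hQa : adjoint Q = Q := (IsSelfAdjoint.of_nonneg (CFC.sqrt_nonneg W)).star_eq
  have hterm : ∀ i, ‖Q (b i)‖ ^ 2 = (inner ℂ (b i) (W (b i))).re := fun i => by
    rw [← hQQ]
    change _ = (inner ℂ (b i) (Q (Q (b i)))).re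
    rw [← adjoint_inner_left, hQa]
    exact (inner_self_eq_norm_sq (𝕜 := ℂ) _).symm
  have hsum : Summable fun i => ‖Q (b i)‖ ^ 2 := by simpa only [hterm] using hb
  have hHS : IsHilbertSchmidt Q := by
    refine ⟨∑' i, ‖Q (b i)‖ ^ 2, ?_⟩
    have := b.hilbertSchmidtBound_adjoint (T := Q)
      fun t => hsum.sum_le_tsum t fun _ _ => by positivity
    rwa [hQa] at this
  refine ⟨U ∘L Q, Q, hHS.clm_comp U, hHS, ?_⟩
  rw [comp_assoc]
  conv_lhs => rw [hU, ← hQQ]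
  rfl

end TraceClass

/-! ### Compressions to an invariant subspace -/

section Compression

open ContinuousLinearMap

variable {H : Type*} [NormedAddCommGroup H] [InnerProductSpace ℂ H]

theorem OrthonormalBasis.sum_sq_norm_inner_coe {ι : Type*} [Fintype ι] {F : Submodule ℂ H}
    [F.HasOrthogonalProjection] (f : OrthonormalBasis ι ℂ F) (y : H) :
    ∑ b, ‖inner ℂ (f b : H) y‖ ^ 2 = ‖F.starProjection y‖ ^ 2 := by
  have h := f.sum_sq_norm_inner_right (F.orthogonalProjectionOnto y)
  rw [Submodule.starProjection_apply, Submodule.norm_coe, ← h]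
  exact Finset.sum_congr rfl fun b _ => by rw [Submodule.inner_orthogonalProjectionOnto_eq_of_mem_left]

theorem Submodule.norm_sq_starProjection_add_le {F S : Submodule ℂ H}
    [F.HasOrthogonalProjection] [S.HasOrthogonalProjection] (hFS : F ≤ Sᗮ) (y : H) :
    ‖S.orthogonalProjectionOnto y‖ ^ 2 + ‖F.starProjection y‖ ^ 2 ≤ ‖y‖ ^ 2 := by
  have h1 : F.starProjection (Sᗮ.starProjection y) = F.starProjection y :=
    congrArg (fun A : H →L[ℂ] H => A y) (Submodule.starProjection_comp_starProjection_of_le hFS)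
  have h2 := F.norm_starProjection_apply_le (Sᗮ.starProjection y)
  rw [h1] at h2
  have h3 := Submodule.norm_sq_eq_add_norm_sq_projection y S
  have h4 : ‖F.starProjection y‖ ^ 2 ≤ ‖Sᗮ.orthogonalProjectionOnto y‖ ^ 2 :=
    pow_le_pow_left₀ (norm_nonneg _) h2 2
  linarith

theorem Submodule.starProjection_tendsto_of_topologicalClosure_eq {V : Submodule ℂ H}
    [V.HasOrthogonalProjection] (F : ℕ → Submodule ℂ H) [∀ n, (F n).HasOrthogonalProjection]
    (hF : Monotone F) (hV : (⨆ n, F n).topologicalClosure = V) (x : H) :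
    Filter.Tendsto (fun n => (F n).starProjection x) Filter.atTop (nhds (V.starProjection x)) := by
  subst hV
  exact Submodule.starProjection_tendsto_closure_iSup F hF x

variable [CompleteSpace H]

/-- The trace estimate on a finite-dimensional subspace `F` of `Sᗮ` that is invariant under `Z*`.
Invariance makes `Z*` and the compression of `Z` to `F` have the same Hilbert–Schmidt norm on `F`, so
that `∑ ‖P_S Z f‖² ≤ ∑ (‖Z f‖² - ‖P_F Z f‖²) = ∑ (‖Z f‖² - ‖Z* f‖²)`, which is the trace of
`[Z*, Z]` over `F`. -/
theorem sum_norm_sq_orthogonalProjectionOnto_le (Z : H →L[ℂ] H) {F S : Submodule ℂ H}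
    [F.HasOrthogonalProjection] [S.HasOrthogonalProjection] (hFS : F ≤ Sᗮ)
    (hZF : ∀ v ∈ F, adjoint Z v ∈ F) {ι : Type*} [Fintype ι] (f : OrthonormalBasis ι ℂ F) :
    ∑ b, ‖S.orthogonalProjectionOnto (Z (f b))‖ ^ 2 ≤
      ∑ b, (inner ℂ (f b : H) (crossCommutator Z Z (f b))).re := by
  have hswap : ∑ b, ‖F.starProjection (Z (f b))‖ ^ 2 = ∑ b, ‖adjoint Z (f b)‖ ^ 2 := by
    simp only [← f.sum_sq_norm_inner_coe]
    rw [Finset.sum_comm]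
    refine Finset.sum_congr rfl fun c _ => ?_
    have h := f.sum_sq_norm_inner_coe (adjoint Z (f c))
    rw [Submodule.starProjection_eq_self_iff.mpr (hZF _ (f c).2)] at h
    rw [← h]
    exact Finset.sum_congr rfl fun b _ => by rw [adjoint_inner_right, norm_inner_symm]
  have hle : ∑ b, (‖S.orthogonalProjectionOnto (Z (f b))‖ ^ 2 + ‖F.starProjection (Z (f b))‖ ^ 2) ≤
      ∑ b, ‖Z (f b)‖ ^ 2 :=
    Finset.sum_le_sum fun b _ => Submodule.norm_sq_starProjection_add_le hFS _
  have hcomm : ∀ b, (inner ℂ (f b : H) (crossCommutator Z Z (f b))).re =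
      ‖Z (f b)‖ ^ 2 - ‖adjoint Z (f b)‖ ^ 2 := fun b => by
    change (inner ℂ (f b : H) (adjoint Z (Z (f b)) - Z (adjoint Z (f b)))).re = _
    rw [inner_sub_right, adjoint_inner_right, ← adjoint_inner_left Z (adjoint Z (f b)),
      Complex.sub_re]
    exact congrArg₂ (· - ·) (inner_self_eq_norm_sq (𝕜 := ℂ) _) (inner_self_eq_norm_sq (𝕜 := ℂ) _)
  rw [Finset.sum_add_distrib, hswap] at hle
  simp only [hcomm, Finset.sum_sub_distrib]
  linarith

/-- If `Sᗮ` is exhausted by finite-dimensional `Z*`-invariant subspaces and `[Z*, Z]` is a product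
of Hilbert–Schmidt operators, then the corner `P_{Sᗮ} Z*|_S` is Hilbert–Schmidt: the estimate
`sum_norm_sq_orthogonalProjectionOnto_le` is uniform in the exhausting subspaces. -/
theorem isHilbertSchmidt_corner (Z : H →L[ℂ] H) (S : Submodule ℂ H) [CompleteSpace S]
    (F : ℕ → Submodule ℂ H) [∀ n, FiniteDimensional ℂ (F n)] (hF : Monotone F)
    (hFS : (⨆ n, F n).topologicalClosure = Sᗮ) (hZF : ∀ n, ∀ v ∈ F n, adjoint Z v ∈ F n)
    {A B : H →L[ℂ] H} (hA : IsHilbertSchmidt A) (hB : IsHilbertSchmidt B)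
    (hC : crossCommutator Z Z = A ∘L B) :
    IsHilbertSchmidt (Sᗮ.starProjection ∘L adjoint Z ∘L S.subtypeL) := by
  obtain ⟨M, hM⟩ := hA.exists_sum_re_inner_comp_le hB
  refine ⟨M, fun s hs => ?_⟩
  have hbound : ∀ n, ∑ g ∈ s, ‖(F n).starProjection (adjoint Z (g : H))‖ ^ 2 ≤ M := fun n => by
    have hle : F n ≤ Sᗮ := hFS ▸ (le_iSup F n).trans (Submodule.le_topologicalClosure _)
    let f := stdOrthonormalBasis ℂ (F n)
    have hf : Orthonormal ℂ fun b => (f b : H) :=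
      f.orthonormal.comp_linearIsometry (F n).subtypeₗᵢ
    calc ∑ g ∈ s, ‖(F n).starProjection (adjoint Z (g : H))‖ ^ 2
        = ∑ b, ∑ g ∈ s, ‖inner ℂ g (S.orthogonalProjectionOnto (Z (f b)))‖ ^ 2 := by
          rw [Finset.sum_comm]
          refine Finset.sum_congr rfl fun g _ => ?_
          rw [← f.sum_sq_norm_inner_coe]
          refine Finset.sum_congr rfl fun b _ => ?_
          rw [adjoint_inner_right, norm_inner_symm,
            Submodule.inner_orthogonalProjectionOnto_eq_of_mem_left]
      _ ≤ ∑ b, ‖S.orthogonalProjectionOnto (Z (f b))‖ ^ 2 := by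
          refine Finset.sum_le_sum fun b _ => ?_
          have := hs.sum_inner_products_le (S.orthogonalProjectionOnto (Z (f b)))
            (s := Finset.univ)
          rwa [Finset.univ_eq_attach, Finset.sum_attach s
            (fun x => ‖inner ℂ x (S.orthogonalProjectionOnto (Z (f b)))‖ ^ 2)] at this
      _ ≤ ∑ b, (inner ℂ (f b : H) (crossCommutator Z Z (f b))).re :=
          sum_norm_sq_orthogonalProjectionOnto_le Z hle (hZF n) f
      _ ≤ M := by
          rw [hC]
          exact hM hf
  refine le_of_tendsto' (x := Filter.atTop) (tendsto_finsetSum s fun g _ => ?_) hbound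
  exact ((Submodule.starProjection_tendsto_of_topologicalClosure_eq F hF hFS _).norm).pow 2

/-- The identity `[Y*, Y'] = P_S [Z*, Z']|_S + (P_{Sᗮ} Z'*|_S)* (P_{Sᗮ} Z*|_S)` for restrictions
`Y`, `Y'` to an invariant subspace. -/
theorem crossCommutator_restrict (Z Z' : H →L[ℂ] H) (S : Submodule ℂ H) [CompleteSpace S]
    (h : ∀ f ∈ S, Z f ∈ S) (h' : ∀ f ∈ S, Z' f ∈ S) :
    crossCommutator (Z.restrict h) (Z'.restrict h') =
      S.orthogonalProjectionOnto ∘L crossCommutator Z Z' ∘L S.subtypeL +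
      adjoint (Sᗮ.starProjection ∘L adjoint Z' ∘L S.subtypeL) ∘L
        (Sᗮ.starProjection ∘L adjoint Z ∘L S.subtypeL) := by
  have hadj : ∀ x : S, adjoint (Z.restrict h) x = S.orthogonalProjectionOnto (adjoint Z x) := by
    intro x
    refine ext_inner_right ℂ fun y => ?_
    rw [adjoint_inner_left, Submodule.inner_orthogonalProjectionOnto_eq_of_mem_right,
      adjoint_inner_left]
    rfl
  ext1 x
  refine ext_inner_right ℂ fun y => ?_
  have hperp : Sᗮ.starProjection (adjoint Z (x : H)) =
      adjoint Z (x : H) - (S.orthogonalProjectionOnto (adjoint Z (x : H)) : H) :=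
    eq_sub_of_add_eq' (S.starProjection_add_starProjection_orthogonal (adjoint Z (x : H)))
  have hlhs : crossCommutator (Z.restrict h) (Z'.restrict h') x =
      adjoint (Z.restrict h) (Z'.restrict h' x) - Z'.restrict h' (adjoint (Z.restrict h) x) := rfl
  have hrhs : crossCommutator Z Z' (x : H) =
      adjoint Z (Z' (x : H)) - Z' (adjoint Z (x : H)) := rfl
  have hcorner : inner ℂ (Sᗮ.starProjection (adjoint Z (x : H)))
      (Sᗮ.starProjection (adjoint Z' (y : H))) =
      inner ℂ (adjoint Z (x : H) - (S.orthogonalProjectionOnto (adjoint Z (x : H)) : H))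
        (adjoint Z' (y : H)) := by
    rw [← hperp, ← Submodule.inner_starProjection_left_eq_right, Submodule.starProjection_eq_self_iff.mpr
      (Submodule.starProjection_apply_mem _ _)]
  rw [add_apply, inner_add_left, comp_apply (adjoint _), adjoint_inner_left]
  simp only [comp_apply, Submodule.subtypeL_apply]
  rw [hcorner, hlhs, hrhs, hadj, hadj, inner_sub_left,
    Submodule.inner_orthogonalProjectionOnto_eq_of_mem_right,
    Submodule.inner_orthogonalProjectionOnto_eq_of_mem_right, inner_sub_left, inner_sub_left,
    adjoint_inner_right, adjoint_inner_right]
  change inner ℂ (adjoint Z (Z' (x : H))) (y : H) -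
    inner ℂ (Z' (S.orthogonalProjectionOnto (adjoint Z (x : H)) : H)) (y : H) = _
  ring

/-- Cross-commutators of restrictions are trace class when those of the ambient operators are
products of Hilbert–Schmidt operators and the corners `P_{Sᗮ} Z*|_S` are Hilbert–Schmidt. -/
theorem isTraceClass_crossCommutator_restrict (Z Z' : H →L[ℂ] H) (S : Submodule ℂ H)
    [CompleteSpace S] (h : ∀ f ∈ S, Z f ∈ S) (h' : ∀ f ∈ S, Z' f ∈ S)
    {A B : H →L[ℂ] H} (hA : IsHilbertSchmidt A) (hB : IsHilbertSchmidt B)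
    (hC : crossCommutator Z Z' = A ∘L B)
    (hZ : IsHilbertSchmidt (Sᗮ.starProjection ∘L adjoint Z ∘L S.subtypeL))
    (hZ' : IsHilbertSchmidt (Sᗮ.starProjection ∘L adjoint Z' ∘L S.subtypeL)) :
    IsTraceClass (crossCommutator (Z.restrict h) (Z'.restrict h')) := by
  rw [crossCommutator_restrict, hC]
  exact isTraceClass_comp_add_comp (A := S.orthogonalProjectionOnto ∘L A) (B := B ∘L S.subtypeL)
    (hA.clm_comp S.orthogonalProjectionOnto)
    (hB.comp_clm S.subtypeL) hZ'.adjoint hZ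

end Compression

/-! ### Operators that raise the degree by one -/

section ClosedSubmoduleGenerated

variable {κ H : Type*} [NormedAddCommGroup H] [InnerProductSpace ℂ H]

theorem subset_closedSubmoduleGenerated (T : κ → H →L[ℂ] H) (G : Set H) :
    G ⊆ closedSubmoduleGenerated T G := fun _ hg =>
  (Submodule.mem_sInf).mpr fun _ hV => hV.2.2 hg

theorem closedSubmoduleGenerated_le {T : κ → H →L[ℂ] H} {G : Set H} {V : Submodule ℂ H}
    (hc : IsClosed (V : Set H)) (hT : ∀ i, ∀ v ∈ V, T i v ∈ V) (hG : G ⊆ V) :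
    closedSubmoduleGenerated T G ≤ V :=
  sInf_le ⟨hc, hT, hG⟩

theorem Submodule.adjoint_mem_orthogonal [CompleteSpace H] {T : H →L[ℂ] H} {S : Submodule ℂ H}
    (hS : ∀ f ∈ S, T f ∈ S) : ∀ v ∈ Sᗮ, ContinuousLinearMap.adjoint T v ∈ Sᗮ := fun v hv =>
  (S.mem_orthogonal _).mpr fun u hu => by
    rw [ContinuousLinearMap.adjoint_inner_right]
    exact (S.mem_orthogonal v).mp hv _ (hS u hu)

end ClosedSubmoduleGenerated

section Graded

open ContinuousLinearMap

variable {ι κ H : Type*} [NormedAddCommGroup H] [InnerProductSpace ℂ H]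
  (b : HilbertBasis ι ℂ H) (deg : ι → ℕ)

/-- The span of the basis vectors of degree at most `n`. -/
def degreeLE (n : ℕ) : Submodule ℂ H := Submodule.span ℂ (b '' {x | deg x ≤ n})

/-- The span of the basis vectors of degree `n`. -/
def degreeEQ (n : ℕ) : Submodule ℂ H := Submodule.span ℂ (b '' {x | deg x = n})

theorem degreeLE_mono : Monotone (degreeLE b deg) := fun _ _ h =>
  Submodule.span_mono (Set.image_mono fun _ hx => le_trans hx h)

theorem degreeEQ_le_degreeLE {d n : ℕ} (h : d ≤ n) : degreeEQ b deg d ≤ degreeLE b deg n :=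
  Submodule.span_mono (Set.image_mono fun _ hx => (le_of_eq hx).trans h)

theorem iSup_degreeLE : ⨆ n, degreeLE b deg n = Submodule.span ℂ (Set.range b) := by
  refine le_antisymm (iSup_le fun n => Submodule.span_mono (Set.image_subset_range _ _)) ?_
  rw [Submodule.span_le]
  rintro _ ⟨x, rfl⟩
  exact Submodule.mem_iSup_of_mem (deg x) (Submodule.subset_span ⟨x, le_refl (deg x), rfl⟩)

theorem mem_degreeLE_of_mem_span {v : H} (hv : v ∈ Submodule.span ℂ (Set.range b)) :
    ∃ n, v ∈ degreeLE b deg n := by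
  rw [← iSup_degreeLE b deg] at hv
  exact (Submodule.mem_iSup_of_directed _ (degreeLE_mono b deg).directed_le).mp hv

theorem topologicalClosure_iSup_degreeLE : ⊤ ≤ (⨆ n, degreeLE b deg n).topologicalClosure := by
  rw [iSup_degreeLE, b.dense_span]

theorem degreeEQ_le_degreeLE_orthogonal {d n : ℕ} (h : n < d) :
    degreeEQ b deg d ≤ (degreeLE b deg n)ᗮ := by
  change Submodule.IsOrtho _ _
  refine Submodule.isOrtho_span.mpr ?_
  rintro _ ⟨x, hx, rfl⟩ _ ⟨y, hy, rfl⟩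
  refine b.orthonormal.2 ?_
  rintro rfl
  exact absurd (hx.symm.trans_le hy) (not_le.mpr h)

theorem starProjection_degreeLE_of_mem_degreeEQ {d n : ℕ}
    [(degreeLE b deg n).HasOrthogonalProjection] {v : H} (hv : v ∈ degreeEQ b deg d) :
    (degreeLE b deg n).starProjection v = if d ≤ n then v else 0 := by
  split_ifs with h
  · exact Submodule.starProjection_eq_self_iff.mpr (degreeEQ_le_degreeLE b deg h hv)
  · exact (Submodule.starProjection_apply_eq_zero_iff _).mpr
      (degreeEQ_le_degreeLE_orthogonal b deg (not_le.mp h) hv)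

theorem basis_mem_degreeEQ (x : ι) : b x ∈ degreeEQ b deg (deg x) :=
  Submodule.subset_span ⟨x, rfl, rfl⟩

variable {b deg} [∀ n, FiniteDimensional ℂ (degreeLE b deg n)]

theorem starProjection_degreeLE_zero_comp {Z : H →L[ℂ] H}
    (hZ : ∀ x, Z (b x) ∈ degreeEQ b deg (deg x + 1)) :
    (degreeLE b deg 0).starProjection ∘L Z = 0 := by
  refine ContinuousLinearMap.ext_on
    (Submodule.dense_iff_topologicalClosure_eq_top.mpr b.dense_span) ?_
  rintro _ ⟨x, rfl⟩
  rw [comp_apply, starProjection_degreeLE_of_mem_degreeEQ b deg (hZ x), if_neg (by omega)]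
  rfl

/-- An operator that raises the degree by one intertwines the consecutive projections onto the
vectors of bounded degree. -/
theorem starProjection_degreeLE_succ_comp {Z : H →L[ℂ] H}
    (hZ : ∀ x, Z (b x) ∈ degreeEQ b deg (deg x + 1)) (n : ℕ) :
    (degreeLE b deg (n + 1)).starProjection ∘L Z = Z ∘L (degreeLE b deg n).starProjection := by
  refine ContinuousLinearMap.ext_on
    (Submodule.dense_iff_topologicalClosure_eq_top.mpr b.dense_span) ?_
  rintro _ ⟨x, rfl⟩
  rw [comp_apply, comp_apply, starProjection_degreeLE_of_mem_degreeEQ b deg (hZ x),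
    starProjection_degreeLE_of_mem_degreeEQ b deg (basis_mem_degreeEQ b deg x)]
  by_cases h : deg x ≤ n
  · rw [if_pos h, if_pos (by omega)]
  · rw [if_neg h, if_neg (by omega), map_zero]

/-- The vectors of bounded degree are dense in `Sᗮ`, if `S` is generated by homogeneous vectors:
the projections onto the vectors of bounded degree preserve `S`, hence also `Sᗮ`. -/
theorem topologicalClosure_iSup_inf_degreeLE_of_homogeneous {Z : κ → H →L[ℂ] H}
    (hZ : ∀ i x, Z i (b x) ∈ degreeEQ b deg (deg x + 1)) {S : Submodule ℂ H} {G : Set H}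
    (hG : ∀ g ∈ G, ∃ d, g ∈ degreeEQ b deg d) (hSG : S = closedSubmoduleGenerated Z G)
    (hS : ∀ i, ∀ f ∈ S, Z i f ∈ S) (hSc : IsClosed (S : Set H)) :
    Sᗮ ≤ (⨆ n, Sᗮ ⊓ degreeLE b deg n).topologicalClosure := by
  let V : Submodule ℂ H := ⨅ n, S.comap (degreeLE b deg n).starProjection.toLinearMap
  have hmem : ∀ v, v ∈ V ↔ ∀ n, (degreeLE b deg n).starProjection v ∈ S := fun v => by
    simp [V, Submodule.mem_iInf]
  have hSV : S ≤ V := by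
    conv_lhs => rw [hSG]
    refine closedSubmoduleGenerated_le ?_ ?_ ?_
    · have : (V : Set H) = ⋂ n, (degreeLE b deg n).starProjection ⁻¹' (S : Set H) := by
        ext v
        simpa using hmem v
      rw [this]
      exact isClosed_iInter fun n => hSc.preimage (ContinuousLinearMap.continuous _)
    · intro i v hv
      rw [hmem] at hv ⊢
      rintro (_ | n)
      · have h := congrArg (fun A : H →L[ℂ] H => A v) (starProjection_degreeLE_zero_comp (hZ i))
        simp only [comp_apply] at h
        rw [h]
        exact S.zero_mem
      · have h := congrArg (fun A : H →L[ℂ] H => A v) (starProjection_degreeLE_succ_comp (hZ i) n)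
        simp only [comp_apply] at h
        rw [h]
        exact hS i _ (hv n)
    · intro g hg
      rw [SetLike.mem_coe, hmem]
      intro n
      obtain ⟨d, hd⟩ := hG g hg
      rw [starProjection_degreeLE_of_mem_degreeEQ b deg hd]
      split_ifs
      · rw [hSG]
        exact subset_closedSubmoduleGenerated _ _ hg
      · exact S.zero_mem
  intro x hx
  refine mem_closure_of_tendsto (Submodule.starProjection_tendsto_self _ (degreeLE_mono b deg) x
    (topologicalClosure_iSup_degreeLE b deg)) (Filter.Eventually.of_forall fun n => ?_)
  refine Submodule.mem_iSup_of_mem n ⟨?_, Submodule.starProjection_apply_mem _ _⟩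
  refine (S.mem_orthogonal _).mpr fun u hu => ?_
  rw [← Submodule.inner_starProjection_left_eq_right]
  exact (S.mem_orthogonal x).mp hx _ ((hmem u).mp (hSV hu) n)

variable [CompleteSpace H]

theorem adjoint_mem_degreeLE {Z : H →L[ℂ] H}
    (hZ : ∀ x, Z (b x) ∈ degreeEQ b deg (deg x + 1)) (n : ℕ) :
    ∀ v ∈ degreeLE b deg n, adjoint Z v ∈ degreeLE b deg n := by
  intro v hv
  have hv' : (degreeLE b deg (n + 1)).starProjection v = v :=
    Submodule.starProjection_eq_self_iff.mpr (degreeLE_mono b deg n.le_succ hv)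
  rw [← Submodule.starProjection_eq_self_iff]
  refine ext_inner_right ℂ fun y => ?_
  have h := congrArg (fun A : H →L[ℂ] H => A y) (starProjection_degreeLE_succ_comp hZ n)
  simp only [comp_apply] at h
  rw [Submodule.inner_starProjection_left_eq_right, adjoint_inner_left, ← h,
    ← Submodule.inner_starProjection_left_eq_right, hv', adjoint_inner_left]

/-- The vectors of bounded degree are dense in `Sᗮ`, if `Sᗮ` is generated under the adjoints by
such vectors: the closure of those that lie in `Sᗮ` is invariant and contains the generators. -/
theorem topologicalClosure_iSup_inf_degreeLE_of_generated {Z : κ → H →L[ℂ] H}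
    (hZ : ∀ i x, Z i (b x) ∈ degreeEQ b deg (deg x + 1)) {S : Submodule ℂ H}
    (hS : ∀ i, ∀ f ∈ S, Z i f ∈ S) {G : Set H} (hG : G ⊆ Submodule.span ℂ (Set.range b))
    (hSG : Sᗮ = closedSubmoduleGenerated (fun i => adjoint (Z i)) G) :
    Sᗮ ≤ (⨆ n, Sᗮ ⊓ degreeLE b deg n).topologicalClosure := by
  conv_lhs => rw [hSG]
  refine closedSubmoduleGenerated_le (Submodule.isClosed_topologicalClosure _) ?_ ?_
  · intro i v hv
    have hmaps : Set.MapsTo (adjoint (Z i)) ((⨆ n, Sᗮ ⊓ degreeLE b deg n : Submodule ℂ H) : Set H)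
        ((⨆ n, Sᗮ ⊓ degreeLE b deg n : Submodule ℂ H) : Set H) := by
      change (⨆ n, Sᗮ ⊓ degreeLE b deg n : Submodule ℂ H) ≤
        (⨆ n, Sᗮ ⊓ degreeLE b deg n).comap (adjoint (Z i)).toLinearMap
      refine iSup_le fun n v hv => Submodule.mem_iSup_of_mem n ⟨?_, ?_⟩
      · exact Submodule.adjoint_mem_orthogonal (hS i) v hv.1
      · exact adjoint_mem_degreeLE (hZ i) n v hv.2
    exact map_mem_closure (adjoint (Z i)).continuous hv hmaps
  · intro g hg
    obtain ⟨n, hn⟩ := mem_degreeLE_of_mem_span b deg (hG hg)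
    refine Submodule.le_topologicalClosure _ (Submodule.mem_iSup_of_mem n ⟨?_, hn⟩)
    rw [hSG]
    exact subset_closedSubmoduleGenerated _ _ hg

/-- Cross-commutators of the restrictions to `S` are trace class, if the vectors of bounded degree
are dense in `Sᗮ`: the vectors of degree at most `n` in `Sᗮ` exhaust it by finite-dimensional
subspaces that are invariant under the adjoints. -/
theorem isTraceClass_crossCommutator_restrict_of_graded {Z : κ → H →L[ℂ] H}
    (hZ : ∀ i x, Z i (b x) ∈ degreeEQ b deg (deg x + 1))
    (hC : ∀ i j, ∃ A B : H →L[ℂ] H,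
      IsHilbertSchmidt A ∧ IsHilbertSchmidt B ∧ crossCommutator (Z i) (Z j) = A ∘L B)
    (S : Submodule ℂ H) [CompleteSpace S] (hS : ∀ i, ∀ f ∈ S, Z i f ∈ S)
    (hcl : Sᗮ ≤ (⨆ n, Sᗮ ⊓ degreeLE b deg n).topologicalClosure) (i j : κ) :
    IsTraceClass (crossCommutator ((Z i).restrict (hS i)) ((Z j).restrict (hS j))) := by
  have hcorner : ∀ i, IsHilbertSchmidt (Sᗮ.starProjection ∘L adjoint (Z i) ∘L S.subtypeL) := by
    intro i
    obtain ⟨A, B, hA, hB, hAB⟩ := hC i i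
    have (n : ℕ) : FiniteDimensional ℂ (Sᗮ ⊓ degreeLE b deg n : Submodule ℂ H) :=
      Submodule.finiteDimensional_of_le inf_le_right
    refine isHilbertSchmidt_corner (Z i) S (fun n => Sᗮ ⊓ degreeLE b deg n)
      (fun n n' h => inf_le_inf_left _ (degreeLE_mono b deg h)) (le_antisymm ?_ hcl)
      (fun n v hv => ⟨Submodule.adjoint_mem_orthogonal (hS i) v hv.1,
        adjoint_mem_degreeLE (hZ i) n v hv.2⟩) hA hB hAB
    exact Submodule.topologicalClosure_minimal _ (iSup_le fun n => inf_le_left)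
      S.isClosed_orthogonal
  obtain ⟨A, B, hA, hB, hAB⟩ := hC i j
  exact isTraceClass_crossCommutator_restrict _ _ S _ _ hA hB hAB (hcorner i) (hcorner j)

end Graded

/-! ### Finite multiplicity -/

section Multiplicity

open ContinuousLinearMap

variable {H : Type*} [NormedAddCommGroup H] [InnerProductSpace ℂ H] [CompleteSpace H]

/-- Finite multiplicity preserves Hilbert–Schmidt operators: `B ⊗ 1` is the sum over `j` of
`(· ⊗ ε_j) ∘ B ∘ (1 ⊗ ε_j*)`, where `ε_j` is the standard basis. -/
theorem IsHilbertSchmidt.rTensor {k : ℕ} [CompleteSpace (H ⊗[ℂ] EuclideanSpace ℂ (Fin k))]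
    {B : H →L[ℂ] H} (hB : IsHilbertSchmidt B) :
    IsHilbertSchmidt (B.rTensor (EuclideanSpace ℂ (Fin k))) := by
  let J (j : Fin k) : H →L[ℂ] H ⊗[ℂ] EuclideanSpace ℂ (Fin k) :=
    (TensorProduct.mkL ℂ H (EuclideanSpace ℂ (Fin k))).flip (EuclideanSpace.single j 1)
  have hJ : ∀ j x, J j x = x ⊗ₜ[ℂ] EuclideanSpace.single j 1 := fun _ _ => rfl
  have hJadj : ∀ j f v, ContinuousLinearMap.adjoint (J j) (f ⊗ₜ[ℂ] v) = v j • f := fun j f v => by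
    refine ext_inner_left ℂ fun y => ?_
    rw [adjoint_inner_right, hJ, TensorProduct.inner_tmul, inner_smul_right,
      EuclideanSpace.inner_single_left, map_one, one_mul, mul_comm]
  have hsum : B.rTensor (EuclideanSpace ℂ (Fin k)) = ∑ j, J j ∘L B ∘L ContinuousLinearMap.adjoint (J j) := by
    ext x
    induction x using TensorProduct.induction_on with
    | zero => simp only [map_zero]
    | add x y hx hy => rw [map_add, map_add, hx, hy]
    | tmul f v =>
      simp only [rTensor_tmul, sum_apply, comp_apply, hJadj, map_smul, hJ,
        TensorProduct.smul_tmul]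
      rw [← TensorProduct.tmul_sum]
      congr 1
      ext l
      simp [Pi.single_apply]
  rw [hsum]
  exact IsHilbertSchmidt.sum _ fun j _ => (hB.comp_clm _).clm_comp (J j)

end Multiplicity

/-! ### The monomial basis of `M_Λ ⊗ ℂ^k` -/

namespace WeightSet

open ContinuousLinearMap

variable {m : ℕ} (Λ : WeightSet m)

/-- The unit vector `z^α / λ_α`. -/
noncomputable def unitMonomial (α : Fin m →₀ ℕ) : Λ.Space := lp.single 2 α 1

theorem ofPoly_monomial_eq_smul (α : Fin m →₀ ℕ) (c : ℂ) :
    Λ.ofPoly (MvPolynomial.monomial α c) = ((Λ.weight α : ℂ) * c) • Λ.unitMonomial α := by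
  rw [ofPoly_monomial, unitMonomial, ← lp.single_smul, smul_eq_mul, mul_one]

theorem unitMonomial_eq_ofPoly (α : Fin m →₀ ℕ) :
    Λ.unitMonomial α = Λ.ofPoly (MvPolynomial.monomial α (Λ.weight α : ℂ)⁻¹) := by
  rw [ofPoly_monomial_eq_smul, mul_inv_cancel₀, one_smul]
  exact_mod_cast (Λ.weight_pos α).ne'

theorem shift_unitMonomial (h : Λ.HasBoundedShifts) (i : Fin m) (α : Fin m →₀ ℕ) :
    ∃ c : ℂ, Λ.shift i (Λ.unitMonomial α) = c • Λ.unitMonomial (Finsupp.single i 1 + α) := by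
  refine ⟨Λ.weight (Finsupp.single i 1 + α) * (1 * (Λ.weight α : ℂ)⁻¹), ?_⟩
  rw [unitMonomial_eq_ofPoly, shift_ofPoly Λ h, MvPolynomial.X, MvPolynomial.monomial_mul,
    ofPoly_monomial_eq_smul]

theorem orthonormal_unitMonomial : Orthonormal ℂ Λ.unitMonomial := by
  rw [orthonormal_iff_ite]
  intro α β
  rw [unitMonomial, unitMonomial, lp.inner_single_left, lp.single_apply]
  by_cases h : α = β
  · subst h
    simp
  · simp [h]

theorem ofPoly_eq_sum (p : MvPolynomial (Fin m) ℂ) :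
    Λ.ofPoly p = ∑ α ∈ p.support, ((Λ.weight α : ℂ) * p.coeff α) • Λ.unitMonomial α := by
  conv_lhs => rw [p.as_sum, map_sum]
  exact Finset.sum_congr rfl fun α _ => Λ.ofPoly_monomial_eq_smul α _

variable (k : ℕ)

/-- The vectors `z^α / λ_α ⊗ ε_j`, with `ε_j` the standard basis of `ℂ^k`. -/
noncomputable def tensorMonomial (x : (Fin m →₀ ℕ) × Fin k) : Λ.TensorSpace k :=
  Λ.tmul (Λ.unitMonomial x.1) (EuclideanSpace.basisFun (Fin k) ℂ x.2)

/-- The elementary tensor as a continuous bilinear map. -/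
noncomputable def tmulL : Λ.Space →L[ℂ] EuclideanSpace ℂ (Fin k) →L[ℂ] Λ.TensorSpace k :=
  TensorProduct.mkL ℂ Λ.Space (EuclideanSpace ℂ (Fin k))

theorem tmulL_apply (f : Λ.Space) (v : EuclideanSpace ℂ (Fin k)) :
    Λ.tmulL k f v = Λ.tmul f v := rfl

theorem orthonormal_tensorMonomial : Orthonormal ℂ (Λ.tensorMonomial k) :=
  Λ.orthonormal_unitMonomial.tmul (EuclideanSpace.basisFun (Fin k) ℂ).orthonormal

theorem tmul_unitMonomial_mem {V : Submodule ℂ (Λ.TensorSpace k)} {α : Fin m →₀ ℕ}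
    (h : ∀ j, Λ.tensorMonomial k (α, j) ∈ V) (v : EuclideanSpace ℂ (Fin k)) :
    Λ.tmul (Λ.unitMonomial α) v ∈ V := by
  rw [← tmulL_apply, ← (EuclideanSpace.basisFun (Fin k) ℂ).sum_repr v, map_sum]
  refine V.sum_mem fun j _ => ?_
  rw [map_smul]
  exact V.smul_mem _ (h j)

theorem tmul_ofPoly_mem {V : Submodule ℂ (Λ.TensorSpace k)} {p : MvPolynomial (Fin m) ℂ}
    (h : ∀ α ∈ p.support, ∀ j, Λ.tensorMonomial k (α, j) ∈ V) (v : EuclideanSpace ℂ (Fin k)) :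
    Λ.tmul (Λ.ofPoly p) v ∈ V := by
  rw [← tmulL_apply, ofPoly_eq_sum, map_sum, sum_apply]
  refine V.sum_mem fun α hα => ?_
  rw [map_smul]
  exact V.smul_mem _ (Λ.tmul_unitMonomial_mem k (h α hα) v)

theorem span_range_tensorMonomial :
    ⊤ ≤ (Submodule.span ℂ (Set.range (Λ.tensorMonomial k))).topologicalClosure := by
  set V := Submodule.span ℂ (Set.range (Λ.tensorMonomial k)) with hV
  have hpoly : ∀ f v, Λ.tmul f v ∈ V.topologicalClosure := fun f v => by
    have hcont : Continuous fun f => Λ.tmulL k f v :=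
      ((Λ.tmulL k).flip v).continuous
    refine Λ.denseRange_ofPoly.induction_on (p := fun f => Λ.tmul f v ∈ V.topologicalClosure) f
      (V.isClosed_topologicalClosure.preimage hcont) fun p => ?_
    exact V.le_topologicalClosure
      (Λ.tmul_ofPoly_mem k (fun α _ j => Submodule.subset_span (Set.mem_range_self (α, j))) v)
  intro x _
  refine TensorProduct.induction_on (motive := fun y => (y : Λ.TensorSpace k) ∈ V.topologicalClosure)
    x (Submodule.zero_mem _) hpoly fun x y hx hy => Submodule.add_mem _ hx hy

/-- The orthonormal basis of `M_Λ ⊗ ℂ^k` that consists of the vectors `z^α / λ_α ⊗ ε_j`. -/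
noncomputable def tensorBasis : HilbertBasis ((Fin m →₀ ℕ) × Fin k) ℂ (Λ.TensorSpace k) :=
  HilbertBasis.mk (Λ.orthonormal_tensorMonomial k) (Λ.span_range_tensorMonomial k)

theorem tensorBasis_apply (x : (Fin m →₀ ℕ) × Fin k) :
    Λ.tensorBasis k x = Λ.tensorMonomial k x :=
  congrFun (HilbertBasis.coe_mk _ _) x

theorem polynomials_le_span : Λ.polynomials k ≤ Submodule.span ℂ (Set.range (Λ.tensorBasis k)) := by
  refine Submodule.span_le.mpr ?_
  rintro _ ⟨p, v, rfl⟩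
  refine Λ.tmul_ofPoly_mem k (fun α _ j => Submodule.subset_span ?_) v
  exact ⟨(α, j), Λ.tensorBasis_apply k _⟩

theorem homogeneousPolynomials_le_degreeEQ (n : ℕ) :
    Λ.homogeneousPolynomials k n ≤ degreeEQ (Λ.tensorBasis k) (fun x => x.1.degree) n := by
  refine Submodule.span_le.mpr ?_
  rintro _ ⟨p, v, hp, rfl⟩
  refine Λ.tmul_ofPoly_mem k (fun α hα j => Submodule.subset_span ?_) v
  have hdeg := hp (MvPolynomial.mem_support_iff.mp hα)
  exact ⟨(α, j), (DFunLike.congr_fun Finsupp.degree_eq_weight_one α).trans hdeg, Λ.tensorBasis_apply k _⟩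

theorem tensorShift_tensorBasis_mem (h : Λ.HasBoundedShifts) (i : Fin m)
    (x : (Fin m →₀ ℕ) × Fin k) :
    Λ.tensorShift k i (Λ.tensorBasis k x) ∈
      degreeEQ (Λ.tensorBasis k) (fun x => x.1.degree) (x.1.degree + 1) := by
  obtain ⟨c, hc⟩ := Λ.shift_unitMonomial h i x.1
  rw [tensorBasis_apply, tensorMonomial, tensorShift_tmul, hc, ← tmulL_apply, map_smul,
    smul_apply]
  refine (degreeEQ (Λ.tensorBasis k) (fun x => x.1.degree) _).smul_mem c (Submodule.subset_span ?_)
  refine ⟨(Finsupp.single i 1 + x.1, x.2), ?_, Λ.tensorBasis_apply k _⟩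
  change (Finsupp.single i 1 + x.1).degree = _
  rw [map_add, Finsupp.degree_single, add_comm]

instance finiteDimensional_degreeLE (n : ℕ) :
    FiniteDimensional ℂ (degreeLE (Λ.tensorBasis k) (fun x => x.1.degree) n) := by
  refine FiniteDimensional.span_of_finite ℂ (Set.Finite.image _ ?_)
  exact ((Finsupp.finite_of_degree_le n).prod Set.finite_univ).subset fun x hx => ⟨hx, trivial⟩

/-- The cross-commutator of `Z_i ⊗ 1` and `Z_j ⊗ 1` is `[Z_i*, Z_j] ⊗ 1`, and so a product of
Hilbert–Schmidt operators. -/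
theorem exists_crossCommutator_tensorShift_eq_comp (h : Λ.HasTraceClassCommutators)
    (i j : Fin m) : ∃ A B : Λ.TensorSpace k →L[ℂ] Λ.TensorSpace k,
      IsHilbertSchmidt A ∧ IsHilbertSchmidt B ∧
        crossCommutator (Λ.tensorShift k i) (Λ.tensorShift k j) = A ∘L B := by
  obtain ⟨A, B, hA, hB, hAB⟩ := (h i j).exists_eq_comp
  have : CompleteSpace (Λ.Space ⊗[ℂ] EuclideanSpace ℂ (Fin k)) :=
    Λ.instCompleteSpaceTensorSpace k
  refine ⟨A.rTensor (EuclideanSpace ℂ (Fin k)), B.rTensor (EuclideanSpace ℂ (Fin k)),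
    hA.rTensor, hB.rTensor, ?_⟩
  have hrT : crossCommutator ((Λ.shift i).rTensor (EuclideanSpace ℂ (Fin k)))
      ((Λ.shift j).rTensor (EuclideanSpace ℂ (Fin k))) =
      (crossCommutator (Λ.shift i) (Λ.shift j)).rTensor (EuclideanSpace ℂ (Fin k)) := by
    rw [crossCommutator, crossCommutator, rTensor_sub, rTensor_mul, rTensor_mul, adjoint_rTensor]
  exact hrT.trans (by rw [hAB, rTensor_comp]; rfl)

end WeightSet

theorem theorem2 {m k : ℕ} (Λ : WeightSet m) (hbdd : Λ.HasBoundedShifts)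
    (htrace : Λ.HasTraceClassCommutators)
    (S : Submodule ℂ (Λ.TensorSpace k)) [CompleteSpace S]
    (hS : ∀ i, ∀ f ∈ S, Λ.tensorShift k i f ∈ S) :
    (Λ.IsGeneratedByPolynomials k Sᗮ →
      ∀ i j : Fin m, IsTraceClass
        (crossCommutator (Λ.restrictedShift k S hS i) (Λ.restrictedShift k S hS j))) ∧
    (Λ.IsHomogeneousSubmodule k S →
      ∀ i j : Fin m, IsTraceClass
        (crossCommutator (Λ.restrictedShift k S hS i) (Λ.restrictedShift k S hS j))) := by
  have hZ := Λ.tensorShift_tensorBasis_mem k hbdd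
  have hC := Λ.exists_crossCommutator_tensorShift_eq_comp k htrace
  constructor
  · rintro ⟨G, hG, hSG⟩
    exact isTraceClass_crossCommutator_restrict_of_graded hZ hC S hS
      (topologicalClosure_iSup_inf_degreeLE_of_generated hZ hS
        (fun g hg => Λ.polynomials_le_span k (hG hg)) hSG)
  · rintro ⟨G, hG, hSG⟩
    exact isTraceClass_crossCommutator_restrict_of_graded hZ hC S hS
      (topologicalClosure_iSup_inf_degreeLE_of_homogeneous hZ
        (fun g hg => (hG g hg).imp fun n hn => Λ.homogeneousPolynomials_le_degreeEQ k n hn) hSG hS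
        (completeSpace_coe_iff_isComplete.mp ‹_›).isClosed)
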